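/- Let $N\ge 0$. Write $L^2=L^2(\mathbb T^2)\otimes\mathbb C^N$ (normalized Lebesgue measure), $\mathbb Z_+=\{0,1,2,\dots\}$, $\mathbb Z_-=\{-1,-2,\dots\}$, and let $H^2$ and $L^2_{--}$ be the spaces of $f\in L^2$ whose Fourier coefficients $\hat f(j_1,j_2)$ vanish for $(j_1,j_2)\notin\mathbb Z_+\times\mathbb Z_+$, respectively for $(j_1,j_2)\notin\mathbb Z_-\times\mathbb Z_-$. An $N\times N$ matrix valued function $\phi$ on $\mathbb D^2$ is called inner if it is holomorphic, $\|\phi(z)\|\le 1$ (operator norm) on $\mathbb D^2$, and the radial limit $\phi(\zeta)=\lim_{r\nearrow1}\phi(r\zeta)$ exists and is unitary for a.e. $\zeta\in\mathbb T^2$. For such $\phi$ put $$\mathcal K_\phi=H^2\cap\phi L^2_{--},\qquad \mathcal K^1_\phi=H^2\cap Z_1\phi L^2_{--},\qquad \mathcal K^2_\phi=H^2\cap Z_2\phi L^2_{--},$$ where $Z_j$ is the $j$-th coordinate function. **Theorem.** Let $\phi=Q/p$ be a rational matrix inner function, where $Q$ is an $N\times N$ matrix of polynomials in $\mathbb C[z_1,z_2]$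 and $p\in\mathbb C[z_1,z_2]$ has no zeros in $\mathbb D^2$ ($p$ may have zeros on $\mathbb T^2$). Let $d=(d_1,d_2)$, where $d_j$ is the maximal degree in $z_j$ of the entries of $Q$, let $\tilde Q(z)=z_1^{d_1}z_2^{d_2}\,Q(1/\bar z_1,1/\bar z_2)^*$ (a matrix polynomial), and let $\tilde\phi=\tilde Q/p$. Define $$\begin{aligned}\mathcal P^0_{d,p}&=\{q/p\in H^2:\ q\in\mathbb C^N[z_1,z_2],\ \deg q\le(d_1-1,d_2-1)\},\\ \mathcal P^1_{d,p}&=\{q/p\in H^2:\ q\in\mathbb C^N[z_1,z_2],\ \deg q\le(d_1,d_2-1)\},\\ \mathcal P^2_{d,p}&=\{q/p\in H^2:\ q\in\mathbb C^N[z_1,z_2],\ \deg q\le(d_1-1,d_2)\},\end{aligned}$$ where a degree bound of $-1$ in either variable means $q=0$. Then $$\mathcal K_\phi=\{f\in\mathcal P^0_{d,p}:\tilde\phi f\in\mathcal P^0_{d,p}\},\quad \mathcal K^1_\phi=\{f\in\mathcal P^1_{d,p}:\tilde\phi f\in\mathcal P^1_{d,p}\},\quad \mathcal K^2_\phi=\{f\in\mathcal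 P^2_{d,p}:\tilde\phi f\in\mathcal P^2_{d,p}\}.$$ In particular, $\mathcal K_\phi$, $\mathcal K^1_\phi$ and $\mathcal K^2_\phi$ are finite dimensional. -/

import Mathlib

open MeasureTheory Filter Topology
open scoped ComplexConjugate Matrix.Norms.L2Operator

noncomputable section

namespace Bidisk

/-! ### The torus, `L²`, and subspaces given by Fourier support -/

/-- The torus `𝕋²`, parametrised by the angles `t ∈ (ℝ/ℤ)²`. -/
abbrev Torus : Type := UnitAddTorus (Fin 2)

/-- Normalised Lebesgue (Haar probability) measure on the torus. -/
abbrev torusMeasure : Measure Torus :=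
  Measure.pi fun _ : Fin 2 => (AddCircle.haarAddCircle : Measure UnitAddCircle)

/-- The point `(e^{2πi t₁}, e^{2πi t₂})` of `ℂ²` with angles `t`. -/
def pt (t : Torus) : Fin 2 → ℂ := fun j => (AddCircle.toCircle (t j) : ℂ)

/-- `L² = L²(𝕋²) ⊗ ℂ^N`. -/
abbrev L2 (N : ℕ) : Type := Lp (EuclideanSpace ℂ (Fin N)) 2 torusMeasure

theorem L2.integrable_mFourier_smul {N : ℕ} (f : L2 N) (n : Fin 2 → ℤ) :
    Integrable (fun t => UnitAddTorus.mFourier n t • f t) torusMeasure := by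
  have hf : Integrable (fun t => f t) torusMeasure :=
    (Lp.memLp f).integrable (by norm_num)
  refine hf.bdd_smul 1 (UnitAddTorus.mFourier n).continuous.aestronglyMeasurable ?_
  filter_upwards with t
  exact ((UnitAddTorus.mFourier n).norm_coe_le_norm t).trans UnitAddTorus.mFourier_norm.le

theorem mFourierCoeff_eq {N : ℕ} (f : Torus → EuclideanSpace ℂ (Fin N)) (n : Fin 2 → ℤ) :
    UnitAddTorus.mFourierCoeff f n
      = ∫ t, UnitAddTorus.mFourier (-n) t • f t ∂torusMeasure := rfl

/-- The functions `f ∈ L²` with `supp f̂ ⊆ S`. -/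
def fourierSupp (N : ℕ) (S : Set (Fin 2 → ℤ)) : Submodule ℂ (L2 N) where
  carrier := {f | ∀ n, n ∉ S → UnitAddTorus.mFourierCoeff f n = 0}
  zero_mem' := by
    intro n _
    rw [mFourierCoeff_eq]
    refine integral_eq_zero_of_ae ?_
    filter_upwards with t
    simp
  add_mem' := by
    intro f g hf hg n hn
    have h1 := hf n hn
    have h2 := hg n hn
    rw [mFourierCoeff_eq] at h1 h2 ⊢
    have : (fun t => UnitAddTorus.mFourier (-n) t • (f + g : L2 N) t) =ᵐ[torusMeasure]
        fun t => UnitAddTorus.mFourier (-n) t • f t + UnitAddTorus.mFourier (-n) t • g t := by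
      filter_upwards [Lp.coeFn_add f g] with t ht
      rw [ht, Pi.add_apply, smul_add]
    rw [integral_congr_ae this, integral_add (L2.integrable_mFourier_smul f _)
      (L2.integrable_mFourier_smul g _), h1, h2, add_zero]
  smul_mem' := by
    intro c f hf n hn
    have h1 := hf n hn
    rw [mFourierCoeff_eq] at h1 ⊢
    have : (fun t => UnitAddTorus.mFourier (-n) t • (c • f : L2 N) t) =ᵐ[torusMeasure]
        fun t => c • (UnitAddTorus.mFourier (-n) t • f t) := by
      filter_upwards [Lp.coeFn_smul c f] with t ht
      rw [ht, Pi.smul_apply, smul_comm]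
    rw [integral_congr_ae this, integral_smul, h1, smul_zero]

/-- The Hardy space `H²` : Fourier support in `ℤ₊ × ℤ₊`. -/
def H2 (N : ℕ) : Submodule ℂ (L2 N) := fourierSupp N {n | ∀ j, 0 ≤ n j}

/-- `L²₋₋` : Fourier support in `ℤ₋ × ℤ₋`, where `ℤ₋ = {-1, -2, …}`. -/
def Lmm (N : ℕ) : Submodule ℂ (L2 N) := fourierSupp N {n | ∀ j, n j < 0}

/-- `Φ W`, the set of those `f ∈ L²` that are a.e. equal to `Φ g` for some `g ∈ W`. -/
def mulImage {N : ℕ} (Φ : Torus → Matrix (Fin N) (Fin N) ℂ) (W : Submodule ℂ (L2 N)) :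
    Submodule ℂ (L2 N) where
  carrier := {f | ∃ g ∈ W, ∀ᵐ t ∂torusMeasure, (f t).ofLp = (Φ t).mulVec (g t).ofLp}
  zero_mem' := by
    refine ⟨0, W.zero_mem, ?_⟩
    filter_upwards [Lp.coeFn_zero (EuclideanSpace ℂ (Fin N)) 2 torusMeasure] with t ht
    simp
  add_mem' := by
    rintro f₁ f₂ ⟨g₁, hg₁, h₁⟩ ⟨g₂, hg₂, h₂⟩
    refine ⟨g₁ + g₂, W.add_mem hg₁ hg₂, ?_⟩
    filter_upwards [Lp.coeFn_add f₁ f₂, Lp.coeFn_add g₁ g₂, h₁, h₂] with t a b c d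
    rw [a, b, Pi.add_apply, Pi.add_apply, WithLp.ofLp_add, WithLp.ofLp_add, c, d,
      Matrix.mulVec_add]
  smul_mem' := by
    rintro c f ⟨g, hg, h⟩
    refine ⟨c • g, W.smul_mem c hg, ?_⟩
    filter_upwards [Lp.coeFn_smul c f, Lp.coeFn_smul c g, h] with t a b d
    rw [a, b, Pi.smul_apply, Pi.smul_apply, WithLp.ofLp_smul, WithLp.ofLp_smul, d,
      Matrix.mulVec_smul]

/-- The set of those `f ∈ L²` with `Φ f ∈ W`. -/
def mulPreimage {N : ℕ} (Φ : Torus → Matrix (Fin N) (Fin N) ℂ) (W : Submodule ℂ (L2 N)) :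
    Set (L2 N) :=
  {f | ∃ h ∈ W, ∀ᵐ t ∂torusMeasure, (h t).ofLp = (Φ t).mulVec (f t).ofLp}

/-! ### Inner functions and their canonical subspaces -/

/-- The open unit bidisk `𝔻²`. -/
def bidisk : Set (Fin 2 → ℂ) := {z | ∀ j, ‖z j‖ < 1}

/-- An `N × N` matrix valued inner function: holomorphic on `𝔻²`, contractive in the operator
norm, with radial limits that exist and are unitary at almost every point of `𝕋²`. -/
structure IsInner {N : ℕ} (φ : (Fin 2 → ℂ) → Matrix (Fin N) (Fin N) ℂ) : Prop where
  holo : DifferentiableOn ℂ φ bidisk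
  contractive : ∀ z ∈ bidisk, ‖φ z‖ ≤ 1
  unitary : ∀ᵐ t ∂torusMeasure, ∃ U ∈ Matrix.unitaryGroup (Fin N) ℂ,
    Tendsto (fun r : ℝ => φ ((r : ℂ) • pt t)) (𝓝[<] 1) (𝓝 U)

/-- Radial boundary values on the torus. -/
def bdry {N : ℕ} (φ : (Fin 2 → ℂ) → Matrix (Fin N) (Fin N) ℂ) (t : Torus) :
    Matrix (Fin N) (Fin N) ℂ :=
  limUnder (𝓝[<] (1 : ℝ)) fun r : ℝ => φ ((r : ℂ) • pt t)

/-- `𝒦_φ = H² ∩ φ L²₋₋`. -/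
def K {N : ℕ} (φ : (Fin 2 → ℂ) → Matrix (Fin N) (Fin N) ℂ) : Submodule ℂ (L2 N) :=
  H2 N ⊓ mulImage (bdry φ) (Lmm N)

/-- `H² ∩ Z_j φ L²₋₋`; this is `𝒦¹_φ` for `j = 0` and `𝒦²_φ` for `j = 1`. -/
def Kj {N : ℕ} (j : Fin 2) (φ : (Fin 2 → ℂ) → Matrix (Fin N) (Fin N) ℂ) :
    Submodule ℂ (L2 N) :=
  H2 N ⊓ mulImage (fun t => pt t j • bdry φ t) (Lmm N)

/-! ### Matrix polynomials -/

/-- Bivariate matrix polynomials, as matrices of polynomials. -/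
abbrev MatPoly (N : ℕ) : Type := Matrix (Fin N) (Fin N) (MvPolynomial (Fin 2) ℂ)

/-- The rational matrix function `Q / p`. -/
def ratFun {N : ℕ} (Q : MatPoly N) (p : MvPolynomial (Fin 2) ℂ) (z : Fin 2 → ℂ) :
    Matrix (Fin N) (Fin N) ℂ :=
  (MvPolynomial.eval z p)⁻¹ • Q.map (MvPolynomial.eval z)

/-- The degree `d = (d₁, d₂)` of `Q`: `d_j` is the largest degree in `z_j` of an entry of `Q`. -/
def matDeg {N : ℕ} (Q : MatPoly N) (j : Fin 2) : ℕ :=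
  Finset.univ.sup fun i => Finset.univ.sup fun k => (Q i k).degreeOf j

/-- `z^d` times the conjugate of `q(1/z̄)`, as a polynomial (for `q` of degree at most `d`). -/
def reflectPoly (d : Fin 2 → ℕ) (q : MvPolynomial (Fin 2) ℂ) : MvPolynomial (Fin 2) ℂ :=
  ∑ m ∈ q.support, MvPolynomial.monomial (Finsupp.equivFunOnFinite.symm d - m) (conj (q.coeff m))

/-- `Q̃(z) = z^d Q(1/z̄)^*`, where `d` is the degree of `Q`; see `eval_reflectMat`. -/
def reflectMat {N : ℕ} (Q : MatPoly N) : MatPoly N :=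
  Matrix.of fun i k => reflectPoly (matDeg Q) (Q k i)

theorem eval_reflectPoly (d : Fin 2 → ℕ) (q : MvPolynomial (Fin 2) ℂ)
    (hq : ∀ j, q.degreeOf j ≤ d j) (z : Fin 2 → ℂ) (hz : ∀ j, z j ≠ 0) :
    MvPolynomial.eval z (reflectPoly d q)
      = (∏ j, z j ^ d j) * conj (MvPolynomial.eval (fun j => 1 / conj (z j)) q) := by
  rw [reflectPoly, map_sum, MvPolynomial.eval_eq', map_sum, Finset.mul_sum]
  refine Finset.sum_congr rfl fun m hm => ?_
  rw [MvPolynomial.eval_monomial, Finsupp.prod_fintype _ _ (by simp)]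
  simp only [map_mul, map_prod, map_pow, map_div₀, map_one, Complex.conj_conj]
  rw [mul_left_comm, ← Finset.prod_mul_distrib]
  congr 1
  refine Finset.prod_congr rfl fun j _ => ?_
  have hle : m j ≤ d j := (MvPolynomial.monomial_le_degreeOf j hm).trans (hq j)
  have hj := hz j
  simp only [Finsupp.coe_tsub, Pi.sub_apply, Finsupp.equivFunOnFinite_symm_apply_apply]
  rw [pow_sub₀ _ hj hle, one_div, inv_pow]

theorem eval_reflectMat {N : ℕ} (Q : MatPoly N) (z : Fin 2 → ℂ) (hz : ∀ j, z j ≠ 0) :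
    (reflectMat Q).map (MvPolynomial.eval z)
      = (∏ j, z j ^ matDeg Q j) •
        (Q.map (MvPolynomial.eval fun j => 1 / conj (z j))).conjTranspose := by
  ext i k
  simp only [reflectMat, Matrix.map_apply, Matrix.of_apply, Matrix.smul_apply,
    Matrix.conjTranspose_apply, smul_eq_mul]
  refine eval_reflectPoly _ _ (fun j => ?_) z hz
  exact (Finset.le_sup (f := fun k' => (Q k k').degreeOf j) (Finset.mem_univ i)).trans
    (Finset.le_sup (f := fun i' => Finset.univ.sup fun k' => (Q i' k').degreeOf j)
      (Finset.mem_univ k))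

/-- The space of all `q / p ∈ H²` with `q ∈ ℂ^N[z]` of degree at most `e = (e₁, e₂)`; the bound
`e_j = -1` forces `q = 0`. -/
def P (N : ℕ) (e : Fin 2 → ℤ) (p : MvPolynomial (Fin 2) ℂ) : Submodule ℂ (L2 N) where
  carrier := {f | f ∈ H2 N ∧ ∃ q : Fin N → MvPolynomial (Fin 2) ℂ,
    (∀ i, ∀ m ∈ (q i).support, ∀ j, (m j : ℤ) ≤ e j) ∧
    ∀ᵐ t ∂torusMeasure, ∀ i,
      f t i = MvPolynomial.eval (pt t) (q i) / MvPolynomial.eval (pt t) p}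
  zero_mem' := by
    refine ⟨(H2 N).zero_mem, 0, by simp, ?_⟩
    filter_upwards [Lp.coeFn_zero (EuclideanSpace ℂ (Fin N)) 2 torusMeasure] with t ht
    simp
  add_mem' := by
    rintro f₁ f₂ ⟨hf₁, q₁, hq₁, h₁⟩ ⟨hf₂, q₂, hq₂, h₂⟩
    refine ⟨(H2 N).add_mem hf₁ hf₂, q₁ + q₂, fun i m hm j => ?_, ?_⟩
    · classical
      rcases Finset.mem_union.1 (MvPolynomial.support_add hm) with h | h
      · exact hq₁ i m h j
      · exact hq₂ i m h j
    · filter_upwards [Lp.coeFn_add f₁ f₂, h₁, h₂] with t a b c i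
      rw [a, Pi.add_apply, PiLp.add_apply, b, c, Pi.add_apply, map_add, add_div]
  smul_mem' := by
    rintro c f ⟨hf, q, hq, h⟩
    refine ⟨(H2 N).smul_mem c hf, c • q, fun i m hm j => ?_, ?_⟩
    · exact hq i m (MvPolynomial.support_smul hm) j
    · filter_upwards [Lp.coeFn_smul c f, h] with t a b i
      rw [a, Pi.smul_apply, PiLp.smul_apply, b, Pi.smul_apply, MvPolynomial.smul_eval,
        smul_eq_mul, mul_div_assoc]

end Bidisk

end

/-!
The argument takes place on the torus, where `p` is nonzero almost everywhere and where `φ = Q / p`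
and `φ̃ = Q̃ / p = ζ^d Q^* / p` almost everywhere. Unitarity of `φ` reads `Q^* Q = Q Q^* = |p|²`,
and it makes `φ^*` and `φ̃` bounded. The three spaces are the cases `s = (0,0), (1,0), (0,1)` of
`H² ∩ ζ^s φ L²₋₋`, with degree bound `e = d - 1 + s`.

Let `f = ζ^s φ g` with `f ∈ H²` and `g ∈ L²₋₋`. Then `p f = ζ^s Q g`: the left side has no negative
frequencies and the right side none beyond `e`, so `p f` is a polynomial of degree at most `e`.
In the same way `p φ̃ f = Q̃ f = ζ^(d + s) p̄ g` is such a polynomial (`mem_P_of_mem_mulImage`).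
Conversely, let `φ̃ f = q / p` with `deg q ≤ e`. Then `g = ζ^(-s) φ^* f` equals `ζ^(-s-d) q / p̄`,
and what remains is to see that it lies in `L²₋₋` (`mem_mulImage_of_mem_mulPreimage`).

Both directions use one analytic fact, `integral_trigPoly_div_eq_zero`: a quotient `h / p` which is
integrable on the torus has mean zero if each frequency of the trigonometric polynomial `h` has a
positive coordinate. It gives `q / p ∈ H²` as soon as `q / p ∈ L²`, and, after conjugation, the
membership `g ∈ L²₋₋`. It holds for `h(ζ) / p(rζ)`, `r < 1`, by Cauchy's theorem in one variable,
and passes to the limit `r → 1` by dominated convergence. The domination is the inequality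
`|p(ζ)| ≤ 2^(deg p) |p(rζ)|` of `norm_eval_pt_le`, which follows by factoring the polynomial
`w ↦ p(wζ)`, whose roots all have modulus at least `1`. The same slices show that `p` vanishes
only on a null set of the torus (`ae_eval_pt_ne_zero`).
-/

namespace Bidisk

/-! ### Polynomials without zeros in the bidisk -/

/-- If all roots of `P` lie outside the open unit disk, then each linear factor satisfies
`|1 - a| ≤ 2 |r - a|`, because `|1 - a| ≤ (1 - r) + |r - a|` and `|r - a| ≥ 1 - r`. -/
theorem norm_eval_one_le {P : Polynomial ℂ} (hP : ∀ w : ℂ, ‖w‖ < 1 → P.eval w ≠ 0)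
    {r : ℝ} (hr0 : 0 ≤ r) (hr1 : r < 1) :
    ‖P.eval 1‖ ≤ 2 ^ P.natDegree * ‖P.eval (r : ℂ)‖ := by
  have hs : P.Splits := IsAlgClosed.splits P
  have key : ∀ s : Multiset ℂ, (∀ a ∈ s, 1 ≤ ‖a‖) →
      ‖(s.map fun a => 1 - a).prod‖ ≤ 2 ^ s.card * ‖(s.map fun a => (r : ℂ) - a).prod‖ := by
    intro s
    induction s using Multiset.induction_on with
    | empty => simp
    | cons a s ih =>
      intro h
      have ha := h a (Multiset.mem_cons_self a s)
      have ih' := ih fun b hb => h b (Multiset.mem_cons_of_mem hb)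
      have h1 : 1 - r ≤ ‖(r : ℂ) - a‖ := by
        have := norm_sub_norm_le a (r : ℂ)
        rw [norm_sub_rev, Complex.norm_real, Real.norm_of_nonneg hr0] at this
        linarith
      have h2 : ‖1 - a‖ ≤ 2 * ‖(r : ℂ) - a‖ := by
        have : ‖(1 : ℂ) - a‖ ≤ ‖(1 : ℂ) - r‖ + ‖(r : ℂ) - a‖ := by
          simpa using norm_add_le ((1 : ℂ) - r) ((r : ℂ) - a)
        have h3 : ‖(1 : ℂ) - r‖ = 1 - r := by
          rw [← Complex.ofReal_one, ← Complex.ofReal_sub, Complex.norm_real,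
            Real.norm_of_nonneg (by linarith)]
        linarith
      rw [Multiset.map_cons, Multiset.prod_cons, Multiset.map_cons, Multiset.prod_cons,
        norm_mul, norm_mul, Multiset.card_cons, pow_succ]
      calc _ ≤ (2 * ‖(r : ℂ) - a‖) *
            (2 ^ s.card * ‖(s.map fun a => (r : ℂ) - a).prod‖) := by gcongr
        _ = _ := by ring
  have hroots : ∀ a ∈ P.roots, 1 ≤ ‖a‖ := by
    intro a ha
    by_contra! h
    exact hP a h (Polynomial.isRoot_of_mem_roots ha)
  rw [hs.eval_eq_prod_roots, hs.eval_eq_prod_roots, norm_mul, norm_mul, hs.natDegree_eq_card_roots]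
  have := mul_le_mul_of_nonneg_left (key _ hroots) (norm_nonneg P.leadingCoeff)
  linarith

/-- The restriction `w ↦ p(w z)` of `p` to the complex line through `0` and `z`. -/
noncomputable def slice (p : MvPolynomial (Fin 2) ℂ) (z : Fin 2 → ℂ) : Polynomial ℂ :=
  MvPolynomial.aeval (fun j => Polynomial.C (z j) * Polynomial.X) p

theorem eval_slice (p : MvPolynomial (Fin 2) ℂ) (z : Fin 2 → ℂ) (w : ℂ) :
    (slice p z).eval w = MvPolynomial.eval (w • z) p := by
  induction p using MvPolynomial.induction_on with
  | C a =>
    have hC : slice (MvPolynomial.C a) z = Polynomial.C a := MvPolynomial.aeval_C _ _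
    rw [hC, Polynomial.eval_C, MvPolynomial.eval_C]
  | add p q hp hq =>
    have hadd : slice (p + q) z = slice p z + slice q z := map_add _ _ _
    rw [hadd, Polynomial.eval_add, hp, hq, map_add]
  | mul_X p j h =>
    have hX : slice (MvPolynomial.X j) z = Polynomial.C (z j) * Polynomial.X :=
      MvPolynomial.aeval_X _ _
    have hmul : slice (p * MvPolynomial.X j) z = slice p z * slice (MvPolynomial.X j) z :=
      map_mul _ _ _
    rw [hmul, hX, Polynomial.eval_mul, h, map_mul, MvPolynomial.eval_X, Polynomial.eval_mul,
      Polynomial.eval_C, Polynomial.eval_X, Pi.smul_apply, smul_eq_mul, mul_comm w]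

theorem natDegree_slice_le (p : MvPolynomial (Fin 2) ℂ) (z : Fin 2 → ℂ) :
    (slice p z).natDegree ≤ p.totalDegree := by
  have := MvPolynomial.aeval_natDegree_le p le_rfl
    (fun j => Polynomial.C (z j) * Polynomial.X) (n := 1)
    (fun j => (Polynomial.natDegree_C_mul_le _ _).trans Polynomial.natDegree_X_le)
  simpa [slice] using this

theorem norm_pt (t : Torus) (j : Fin 2) : ‖pt t j‖ = 1 := Circle.norm_coe _

theorem pt_ne_zero (t : Torus) (j : Fin 2) : pt t j ≠ 0 := by
  rw [← norm_ne_zero_iff, norm_pt]; exact one_ne_zero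

theorem continuous_pt : Continuous pt := by
  refine continuous_pi fun j => ?_
  exact continuous_subtype_val.comp (AddCircle.continuous_toCircle.comp (continuous_apply j))

theorem smul_pt_mem_bidisk {w : ℂ} (hw : ‖w‖ < 1) (t : Torus) : w • pt t ∈ bidisk := fun j => by
  rw [Pi.smul_apply, smul_eq_mul, norm_mul, norm_pt, mul_one]; exact hw

/-- Radial comparison: a polynomial without zeros in the bidisk satisfies
`|p(ζ)| ≤ C |p(rζ)|` on the torus, uniformly in `0 ≤ r < 1`. -/
theorem norm_eval_pt_le {p : MvPolynomial (Fin 2) ℂ}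
    (hp : ∀ z ∈ bidisk, MvPolynomial.eval z p ≠ 0) {r : ℝ} (hr0 : 0 ≤ r) (hr1 : r < 1)
    (t : Torus) :
    ‖MvPolynomial.eval (pt t) p‖
      ≤ 2 ^ p.totalDegree * ‖MvPolynomial.eval ((r : ℂ) • pt t) p‖ := by
  have h := norm_eval_one_le (P := slice p (pt t))
    (fun w hw => by rw [eval_slice]; exact hp _ (smul_pt_mem_bidisk hw t)) hr0 hr1
  rw [eval_slice, eval_slice, one_smul] at h
  refine h.trans ?_
  gcongr
  · norm_num
  · exact natDegree_slice_le p _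

/-! ### Averaging over rotations -/

/-- The slice `w ↦ p(w z)` is not the zero polynomial, since `p 0 ≠ 0`; so it has finitely many
roots on the circle. -/
theorem finite_root_angles {p : MvPolynomial (Fin 2) ℂ}
    (hp : ∀ z ∈ bidisk, MvPolynomial.eval z p ≠ 0) (z : Fin 2 → ℂ) :
    {s : UnitAddCircle | MvPolynomial.eval ((AddCircle.toCircle s : ℂ) • z) p = 0}.Finite := by
  have hne : slice p z ≠ 0 := by
    intro h
    have h0 := eval_slice p z 0
    rw [h, Polynomial.eval_zero, zero_smul] at h0
    exact hp 0 (fun j => by simp) h0.symm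
  have hfin : {w : ℂ | (slice p z).IsRoot w}.Finite := Polynomial.finite_setOfPred_isRoot hne
  refine (hfin.preimage (f := fun s : UnitAddCircle => (AddCircle.toCircle s : ℂ)) ?_).subset ?_
  · exact (Subtype.val_injective.comp (AddCircle.injective_toCircle one_ne_zero)).injOn
  · intro s hs
    simpa [Polynomial.IsRoot, eval_slice] using hs

theorem pt_add_const (t : Torus) (s : UnitAddCircle) :
    pt (t + fun _ => s) = (AddCircle.toCircle s : ℂ) • pt t := by
  ext j
  simp [pt, AddCircle.toCircle_add, mul_comm]

/-- A polynomial without zeros in the bidisk is nonzero almost everywhere on the torus: it has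
finitely many zeros on each orbit of the diagonal circle action. -/
theorem ae_eval_pt_ne_zero {p : MvPolynomial (Fin 2) ℂ}
    (hp : ∀ z ∈ bidisk, MvPolynomial.eval z p ≠ 0) :
    ∀ᵐ t ∂torusMeasure, MvPolynomial.eval (pt t) p ≠ 0 := by
  set ν : Measure UnitAddCircle := AddCircle.haarAddCircle
  have hmeas : MeasurableSet {x : UnitAddCircle × Torus |
      ¬ MvPolynomial.eval (pt (x.2 + fun _ => x.1)) p ≠ 0} := by
    have : Continuous fun x : UnitAddCircle × Torus =>
        MvPolynomial.eval (pt (x.2 + fun _ => x.1)) p :=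
      (MvPolynomial.continuous_eval p).comp (continuous_pt.comp (by fun_prop))
    have h := (isClosed_singleton (x := (0 : ℂ))).preimage this |>.measurableSet
    simpa [Set.preimage] using h
  have h1 : ∀ᵐ t ∂torusMeasure, ∀ᵐ s ∂ν,
      MvPolynomial.eval (pt (t + fun _ => s)) p ≠ 0 := by
    refine Eventually.of_forall fun t => ?_
    have : ν {s | MvPolynomial.eval ((AddCircle.toCircle s : ℂ) • pt t) p = 0} = 0 := by
      have : Nontrivial Circle := ⟨1, Circle.exp Real.pi, fun h => by
        have h' : ((1 : Circle) : ℂ) = Circle.exp Real.pi := congrArg _ h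
        rw [Circle.coe_exp, Complex.exp_pi_mul_I, Circle.coe_one] at h'
        norm_num at h'⟩
      have : Nontrivial UnitAddCircle :=
        (AddCircle.homeomorphCircle (T := (1 : ℝ)) one_ne_zero).toEquiv.nontrivial
      have : (𝓝[≠] (0 : UnitAddCircle)).NeBot :=
        ConnectedSpace.neBot_nhdsWithin_compl_of_nontrivial_of_t1space _
      exact (finite_root_angles hp (pt t)).measure_zero ν
    rw [ae_iff]
    simpa [pt_add_const] using this
  have h2 : ∀ᵐ s ∂ν, ∀ᵐ t ∂torusMeasure, MvPolynomial.eval (pt (t + fun _ => s)) p ≠ 0 :=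
    (Measure.ae_ae_comm (p := fun t s => MvPolynomial.eval (pt (t + fun _ => s)) p ≠ 0)
      (by
        have := hmeas.compl.preimage measurable_swap
        simpa [Set.preimage, Set.compl_def] using this)).1 h1
  obtain ⟨s, hs⟩ := h2.exists
  exact (eventually_add_right_iff torusMeasure (fun _ => s)).1 hs

/-- By rotation invariance, a function on the torus has mean zero if its mean over each orbit of a
family of rotations `t ↦ t + v s` is zero. -/
theorem integral_eq_zero_of_rotation {F : Torus → ℂ} (hF : Continuous F)
    {v : UnitAddCircle → Torus} (hv : Continuous v)
    (h : ∀ t, ∫ s, F (t + v s) ∂AddCircle.haarAddCircle = 0) :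
    ∫ t, F t ∂torusMeasure = 0 := by
  have hcont : Continuous fun x : Torus × UnitAddCircle => F (x.1 + v x.2) := by fun_prop
  have hint : Integrable (Function.uncurry fun (t : Torus) (s : UnitAddCircle) => F (t + v s))
      (torusMeasure.prod AddCircle.haarAddCircle) :=
    hcont.integrable_of_hasCompactSupport (HasCompactSupport.of_compactSpace _)
  have h1 := integral_integral_swap hint
  simp_rw [h, integral_add_right_eq_self] at h1
  simpa using h1.symm

/-- The mean value property for `w ↦ w ^ k G w`, which vanishes at `0`. -/
theorem integral_circle_eq_zero {G : ℂ → ℂ} (hG : DifferentiableOn ℂ G (Metric.closedBall 0 1))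
    {k : ℤ} (hk : 0 < k) :
    ∫ s : UnitAddCircle, fourier k s * G (AddCircle.toCircle s) ∂AddCircle.haarAddCircle = 0 := by
  obtain ⟨n, rfl⟩ := Int.eq_ofNat_of_zero_le hk.le
  have hn : n ≠ 0 := by omega
  have havg : Real.circleAverage (fun w => w ^ n * G w) 0 1 = 0 := by
    have hd : DiffContOnCl ℂ (fun w => w ^ n * G w) (Metric.ball 0 |1|) := by
      have : DifferentiableOn ℂ (fun w => w ^ n * G w) (Metric.closedBall 0 1) :=
        (differentiableOn_id.pow n).mul hG
      refine DifferentiableOn.diffContOnCl ?_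
      rwa [abs_one, closure_ball _ one_ne_zero]
    rw [hd.circleAverage, zero_pow hn, zero_mul]
  rw [Real.circleAverage_def] at havg
  rw [AddCircle.integral_haarAddCircle, ← UnitAddCircle.intervalIntegral_preimage 0]
  have h : ∀ x : ℝ, fourier (n : ℤ) (x : UnitAddCircle) *
        G (AddCircle.toCircle (x : UnitAddCircle)) =
      (fun θ : ℝ => circleMap 0 1 θ ^ n * G (circleMap 0 1 θ)) (2 * Real.pi * x) := by
    intro x
    have : (AddCircle.toCircle (x : UnitAddCircle) : ℂ) = circleMap 0 1 (2 * Real.pi * x) := by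
      simp [AddCircle.toCircle_apply_mk, circleMap, Circle.coe_exp]
    simp only [fourier_apply, natCast_zsmul, AddCircle.toCircle_nsmul, Circle.coe_pow, this]
  simp_rw [h]
  have hc := intervalIntegral.integral_comp_mul_left (a := 0) (b := 1)
    (fun θ : ℝ => circleMap 0 1 θ ^ n * G (circleMap 0 1 θ)) Real.two_pi_pos.ne'
  rw [mul_zero, mul_one, havg] at hc
  simpa using hc

/-! ### Fourier coefficients of quotients by `p` -/

theorem mFourier_add_single (k : Fin 2 → ℤ) (t : Torus) (j : Fin 2) (s : UnitAddCircle) :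
    UnitAddTorus.mFourier k (t + Pi.single j s) = UnitAddTorus.mFourier k t * fourier (k j) s := by
  have h : ∏ i, fourier (k i) ((Pi.single j s : Torus) i) = fourier (k j) s := by
    rw [Finset.prod_eq_single j]
    · rw [Pi.single_eq_same]
    · intro i _ hi
      rw [Pi.single_eq_of_ne hi, fourier_eval_zero]
    · simp
  rw [← h]
  simp only [UnitAddTorus.mFourier, ContinuousMap.coe_mk, ← Finset.prod_mul_distrib, Pi.add_apply]
  refine Finset.prod_congr rfl fun i _ => ?_
  rw [fourier_apply, zsmul_add, AddCircle.toCircle_add, Circle.coe_mul, fourier_apply,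
    fourier_apply]

theorem continuous_inv_eval_dilate {p : MvPolynomial (Fin 2) ℂ}
    (hp : ∀ z ∈ bidisk, MvPolynomial.eval z p ≠ 0) {r : ℝ} (hr0 : 0 ≤ r) (hr1 : r < 1) :
    Continuous fun t => (MvPolynomial.eval ((r : ℂ) • pt t) p)⁻¹ :=
  ((MvPolynomial.continuous_eval p).comp (continuous_pt.const_smul (r : ℂ))).inv₀ fun t =>
    hp _ (smul_pt_mem_bidisk (by rwa [Complex.norm_real, Real.norm_of_nonneg hr0]) t)

/-- Cauchy's theorem in the `j`-th variable, for the dilates `1 / p(rζ)`. -/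
theorem integral_mFourier_mul_inv_dilate {p : MvPolynomial (Fin 2) ℂ}
    (hp : ∀ z ∈ bidisk, MvPolynomial.eval z p ≠ 0) {r : ℝ} (hr0 : 0 ≤ r) (hr1 : r < 1)
    {k : Fin 2 → ℤ} {j : Fin 2} (hk : 0 < k j) :
    ∫ t, UnitAddTorus.mFourier k t * (MvPolynomial.eval ((r : ℂ) • pt t) p)⁻¹ ∂torusMeasure
      = 0 := by
  refine integral_eq_zero_of_rotation (v := fun s => Pi.single j s)
    ((UnitAddTorus.mFourier k).continuous.mul (continuous_inv_eval_dilate hp hr0 hr1))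
    (continuous_single (A := fun _ : Fin 2 => UnitAddCircle) j) fun t => ?_
  -- rotating the `j`-th coordinate moves `r • pt t` along the analytic disk `w ↦ z w`
  set z : ℂ → Fin 2 → ℂ := fun w i => (r : ℂ) * pt t i * (if i = j then w else 1) with hz
  have hzmem : ∀ w ∈ Metric.closedBall (0 : ℂ) 1, z w ∈ bidisk := by
    intro w hw i
    rw [mem_closedBall_zero_iff] at hw
    have h1 : ‖(if i = j then w else 1 : ℂ)‖ ≤ 1 := by split_ifs <;> simp [hw]
    rw [hz, norm_mul, norm_mul, norm_pt, mul_one, Complex.norm_real, Real.norm_of_nonneg hr0]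
    nlinarith [norm_nonneg (if i = j then w else 1 : ℂ)]
  have hdiff : DifferentiableOn ℂ (fun w => (MvPolynomial.eval (z w) p)⁻¹)
      (Metric.closedBall 0 1) := by
    refine DifferentiableOn.inv ?_ fun w hw => hp _ (hzmem w hw)
    have h : ∀ w, MvPolynomial.eval (z w) p =
        ∑ m ∈ p.support, p.coeff m * ∏ i, z w i ^ m i := fun w => MvPolynomial.eval_eq' _ _
    simp_rw [h]
    refine Differentiable.differentiableOn ?_
    have hzi : ∀ i, Differentiable ℂ fun w => z w i := by
      intro i
      simp only [hz]
      split_ifs <;> fun_prop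
    fun_prop
  have hrot : ∀ s : UnitAddCircle, (r : ℂ) • pt (t + Pi.single j s) = z (AddCircle.toCircle s) := by
    intro s
    ext i
    simp only [hz, pt, Pi.smul_apply, smul_eq_mul, Pi.add_apply, AddCircle.toCircle_add,
      Circle.coe_mul, ← mul_assoc]
    by_cases h : i = j
    · subst h; simp
    · simp [h]
  simp_rw [mFourier_add_single, hrot, mul_assoc]
  rw [integral_const_mul, integral_circle_eq_zero hdiff hk, mul_zero]

/-- Let `h` be a trigonometric polynomial all of whose frequencies have a positive coordinate. If
`h / p` is integrable then it has mean zero. The quotients `h(ζ) / p(rζ)` have mean zero by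
Cauchy's theorem, and radial comparison makes them converge dominatedly to `h / p`. -/
theorem integral_trigPoly_div_eq_zero {p : MvPolynomial (Fin 2) ℂ}
    (hp : ∀ z ∈ bidisk, MvPolynomial.eval z p ≠ 0) {ι : Type*} (S : Finset ι) (c : ι → ℂ)
    (κ : ι → Fin 2 → ℤ) (hκ : ∀ i ∈ S, ∃ j, 0 < κ i j) {F : Torus → ℂ}
    (hF : Integrable F torusMeasure)
    (hFeq : ∀ᵐ t ∂torusMeasure, F t =
      (∑ i ∈ S, c i * UnitAddTorus.mFourier (κ i) t) / MvPolynomial.eval (pt t) p) :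
    ∫ t, F t ∂torusMeasure = 0 := by
  set h : Torus → ℂ := fun t => ∑ i ∈ S, c i * UnitAddTorus.mFourier (κ i) t with hh
  have hcont : Continuous h := by
    refine continuous_finsetSum _ fun i _ => ?_
    exact continuous_const.mul (UnitAddTorus.mFourier (κ i)).continuous
  obtain ⟨u, -, hu, hlim⟩ := exists_seq_strictMono_tendsto' (show (0 : ℝ) < 1 by norm_num)
  have hzero : ∀ n, ∫ t, h t * (MvPolynomial.eval ((u n : ℂ) • pt t) p)⁻¹ ∂torusMeasure = 0 := by
    intro n
    have hcinv := continuous_inv_eval_dilate hp (hu n).1.le (hu n).2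
    simp_rw [hh, Finset.sum_mul, mul_assoc]
    rw [integral_finsetSum]
    · refine Finset.sum_eq_zero fun i hi => ?_
      obtain ⟨j, hj⟩ := hκ i hi
      rw [integral_const_mul, integral_mFourier_mul_inv_dilate hp (hu n).1.le (hu n).2 hj, mul_zero]
    · intro i _
      exact (continuous_const.mul ((UnitAddTorus.mFourier (κ i)).continuous.mul hcinv)
        ).integrable_of_hasCompactSupport (HasCompactSupport.of_compactSpace _)
  have hconv : Tendsto (fun n => ∫ t, h t * (MvPolynomial.eval ((u n : ℂ) • pt t) p)⁻¹
      ∂torusMeasure) atTop (𝓝 (∫ t, F t ∂torusMeasure)) := by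
    refine tendsto_integral_of_dominated_convergence (fun t => 2 ^ p.totalDegree * ‖F t‖) ?_
      (hF.norm.const_mul _) ?_ ?_
    · exact fun n =>
        (hcont.mul (continuous_inv_eval_dilate hp (hu n).1.le (hu n).2)).aestronglyMeasurable
    · intro n
      filter_upwards [hFeq, ae_eval_pt_ne_zero hp] with t ht hne
      have hr := norm_eval_pt_le hp (hu n).1.le (hu n).2 t
      have hpos : 0 < ‖MvPolynomial.eval ((u n : ℂ) • pt t) p‖ := norm_pos_iff.2 <|
        hp _ (smul_pt_mem_bidisk
          (by rw [Complex.norm_real, Real.norm_of_nonneg (hu n).1.le]; exact (hu n).2) t)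
      rw [ht, norm_mul, norm_inv, norm_div, ← div_eq_mul_inv, mul_div_assoc',
        div_le_div_iff₀ hpos (norm_pos_iff.2 hne)]
      nlinarith [norm_nonneg (h t)]
    · filter_upwards [hFeq, ae_eval_pt_ne_zero hp] with t ht hne
      rw [ht, div_eq_mul_inv]
      refine tendsto_const_nhds.mul (Tendsto.inv₀ ?_ hne)
      have hc : Continuous fun r : ℝ => MvPolynomial.eval ((r : ℂ) • pt t) p :=
        (MvPolynomial.continuous_eval p).comp (by fun_prop)
      have h1 := (hc.tendsto 1).comp hlim
      rwa [Complex.ofReal_one, one_smul] at h1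
  simp_rw [hzero] at hconv
  exact tendsto_nhds_unique hconv tendsto_const_nhds

/-! ### Trigonometric polynomials and Fourier support -/

/-- An exponent of a monomial, seen as a frequency in `ℤ²`. -/
def freq (m : Fin 2 →₀ ℕ) : Fin 2 → ℤ := fun j => m j

theorem prod_pt_pow (m : Fin 2 → ℕ) (t : Torus) :
    ∏ j, pt t j ^ m j = UnitAddTorus.mFourier (fun j => (m j : ℤ)) t := by
  simp only [UnitAddTorus.mFourier, ContinuousMap.coe_mk]
  refine Finset.prod_congr rfl fun j _ => ?_
  rw [fourier_apply, natCast_zsmul, AddCircle.toCircle_nsmul, Circle.coe_pow, pt]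

theorem norm_mFourier_apply (n : Fin 2 → ℤ) (t : Torus) : ‖UnitAddTorus.mFourier n t‖ = 1 := by
  simp only [UnitAddTorus.mFourier, ContinuousMap.coe_mk, norm_prod, fourier_apply,
    Circle.norm_coe, Finset.prod_const_one]

theorem eval_pt (q : MvPolynomial (Fin 2) ℂ) (t : Torus) :
    MvPolynomial.eval (pt t) q
      = ∑ m ∈ q.support, q.coeff m * UnitAddTorus.mFourier (freq m) t := by
  rw [MvPolynomial.eval_eq']
  exact Finset.sum_congr rfl fun m _ => by rw [prod_pt_pow]; rfl

theorem conj_eval_pt (q : MvPolynomial (Fin 2) ℂ) (t : Torus) :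
    conj (MvPolynomial.eval (pt t) q)
      = ∑ m ∈ q.support, conj (q.coeff m) * UnitAddTorus.mFourier (-freq m) t := by
  rw [eval_pt, map_sum]
  exact Finset.sum_congr rfl fun m _ => by rw [map_mul, UnitAddTorus.mFourier_neg]

theorem mFourierCoeff_eq_mul (F : Torus → ℂ) (n : Fin 2 → ℤ) :
    UnitAddTorus.mFourierCoeff F n
      = ∫ t, UnitAddTorus.mFourier (-n) t * F t ∂torusMeasure := rfl

theorem mFourierCoeff_congr {F G : Torus → ℂ} (h : F =ᵐ[torusMeasure] G) (n : Fin 2 → ℤ) :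
    UnitAddTorus.mFourierCoeff F n = UnitAddTorus.mFourierCoeff G n := by
  rw [mFourierCoeff_eq_mul, mFourierCoeff_eq_mul]
  exact integral_congr_ae (h.mono fun t ht => by simp only [ht])

theorem integrable_mFourier_mul {F : Torus → ℂ} (hF : Integrable F torusMeasure)
    (n : Fin 2 → ℤ) : Integrable (fun t => UnitAddTorus.mFourier n t * F t) torusMeasure :=
  hF.bdd_mul (c := 1) (UnitAddTorus.mFourier n).continuous.aestronglyMeasurable <|
    Eventually.of_forall fun t => (norm_mFourier_apply n t).le

/-- Multiplication by a trigonometric polynomial is a convolution on the Fourier side. -/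
theorem mFourierCoeff_trigPoly_mul {ι : Type*} (S : Finset ι) (c : ι → ℂ) (κ : ι → Fin 2 → ℤ)
    {F : Torus → ℂ} (hF : Integrable F torusMeasure) (n : Fin 2 → ℤ) :
    UnitAddTorus.mFourierCoeff
        (fun t => (∑ i ∈ S, c i * UnitAddTorus.mFourier (κ i) t) * F t) n
      = ∑ i ∈ S, c i * UnitAddTorus.mFourierCoeff F (n - κ i) := by
  have h : ∀ t, UnitAddTorus.mFourier (-n) t *
        ((∑ i ∈ S, c i * UnitAddTorus.mFourier (κ i) t) * F t)
      = ∑ i ∈ S, c i * (UnitAddTorus.mFourier (-(n - κ i)) t * F t) := by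
    intro t
    rw [Finset.sum_mul, Finset.mul_sum]
    refine Finset.sum_congr rfl fun i _ => ?_
    rw [neg_sub, sub_eq_add_neg, UnitAddTorus.mFourier_add]
    ring
  rw [mFourierCoeff_eq_mul]
  simp_rw [h]
  rw [integral_finsetSum _ fun i _ => (integrable_mFourier_mul hF _).const_mul _]
  exact Finset.sum_congr rfl fun i _ => by rw [integral_const_mul, mFourierCoeff_eq_mul]

theorem mFourierCoeff_eval_mul (q : MvPolynomial (Fin 2) ℂ) {F : Torus → ℂ}
    (hF : Integrable F torusMeasure) (n : Fin 2 → ℤ) :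
    UnitAddTorus.mFourierCoeff (fun t => MvPolynomial.eval (pt t) q * F t) n
      = ∑ m ∈ q.support, q.coeff m * UnitAddTorus.mFourierCoeff F (n - freq m) := by
  simp_rw [eval_pt]
  exact mFourierCoeff_trigPoly_mul _ _ _ hF n

theorem mFourierCoeff_finsetSum {ι : Type*} (S : Finset ι) {F : ι → Torus → ℂ}
    (hF : ∀ i ∈ S, Integrable (F i) torusMeasure) (n : Fin 2 → ℤ) :
    UnitAddTorus.mFourierCoeff (fun t => ∑ i ∈ S, F i t) n
      = ∑ i ∈ S, UnitAddTorus.mFourierCoeff (F i) n := by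
  rw [mFourierCoeff_eq_mul]
  simp_rw [Finset.mul_sum]
  exact integral_finsetSum _ fun i hi => integrable_mFourier_mul (hF i hi) _

theorem memLp_apply {N : ℕ} (f : L2 N) (i : Fin N) :
    MemLp (fun t => f t i) 2 torusMeasure :=
  (Lp.memLp f).eval_piLp i

theorem integrable_apply {N : ℕ} (f : L2 N) (i : Fin N) :
    Integrable (fun t => f t i) torusMeasure :=
  (memLp_apply f i).integrable (by norm_num)

theorem mFourierCoeff_apply {N : ℕ} (f : L2 N) (n : Fin 2 → ℤ) (i : Fin N) :
    UnitAddTorus.mFourierCoeff f n i = UnitAddTorus.mFourierCoeff (fun t => f t i) n := by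
  rw [mFourierCoeff_eq, mFourierCoeff_eq_mul]
  exact ((EuclideanSpace.proj (𝕜 := ℂ) i).integral_comp_comm
    (L2.integrable_mFourier_smul f (-n))).symm

theorem mem_fourierSupp_iff {N : ℕ} {S : Set (Fin 2 → ℤ)} {f : L2 N} :
    f ∈ fourierSupp N S ↔
      ∀ i, ∀ n ∉ S, UnitAddTorus.mFourierCoeff (fun t => f t i) n = 0 := by
  constructor
  · intro h i n hn
    rw [← mFourierCoeff_apply, h n hn]
    rfl
  · intro h n hn
    ext i
    rw [mFourierCoeff_apply, h i n hn]
    rfl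

/-- An `L²` function with finitely many nonzero Fourier coefficients is a.e. a trigonometric
polynomial. -/
theorem ae_eq_trigPoly {F : Torus → ℂ} (hF : MemLp F 2 torusMeasure) {B : Finset (Fin 2 → ℤ)}
    (hB : ∀ n ∉ B, UnitAddTorus.mFourierCoeff F n = 0) :
    F =ᵐ[torusMeasure]
      fun t => ∑ n ∈ B, UnitAddTorus.mFourierCoeff F n * UnitAddTorus.mFourier n t := by
  have hcoeff : ∀ n, UnitAddTorus.mFourierCoeff (hF.toLp F) n = UnitAddTorus.mFourierCoeff F n :=
    mFourierCoeff_congr hF.coeFn_toLp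
  have hsum := UnitAddTorus.hasSum_mFourier_series_L2 (hF.toLp F)
  have hfin := hasSum_sum_of_ne_finset_zero (s := B) (L := .unconditional _)
    (f := fun n => UnitAddTorus.mFourierCoeff (hF.toLp F) n • UnitAddTorus.mFourierLp 2 n)
    fun n hn => by rw [hcoeff, hB n hn, zero_smul]
  have heq := hsum.unique hfin
  simp_rw [hcoeff] at heq
  have htoLp : ∑ n ∈ B, UnitAddTorus.mFourierCoeff F n • UnitAddTorus.mFourierLp 2 n
      = ContinuousMap.toLp (E := ℂ) 2 torusMeasure ℂ
        (∑ n ∈ B, UnitAddTorus.mFourierCoeff F n • UnitAddTorus.mFourier n) := by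
    rw [map_sum]
    simp_rw [map_smul]
    rfl
  rw [htoLp] at heq
  have h1 := hF.coeFn_toLp
  rw [heq] at h1
  filter_upwards [h1, ContinuousMap.coeFn_toLp (𝕜 := ℂ) (p := 2) torusMeasure
    (∑ n ∈ B, UnitAddTorus.mFourierCoeff F n • UnitAddTorus.mFourier n)] with t ha hb
  rw [← ha, hb]
  simp

/-- An `L²` function whose Fourier support lies in the box `0 ≤ n ≤ e` is a.e. a polynomial with
exponents in that box. -/
theorem exists_poly_of_fourierSupp {F : Torus → ℂ} (hF : MemLp F 2 torusMeasure) (e : Fin 2 → ℤ)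
    (hpos : ∀ n, (∃ j, n j < 0) → UnitAddTorus.mFourierCoeff F n = 0)
    (hle : ∀ n, (∃ j, e j < n j) → UnitAddTorus.mFourierCoeff F n = 0) :
    ∃ q : MvPolynomial (Fin 2) ℂ, (∀ m ∈ q.support, ∀ j, (m j : ℤ) ≤ e j) ∧
      ∀ᵐ t ∂torusMeasure, F t = MvPolynomial.eval (pt t) q := by
  set B : Finset (Fin 2 → ℤ) := Fintype.piFinset fun j => Finset.Icc 0 (e j) with hB
  have hmem : ∀ n, n ∈ B ↔ ∀ j, 0 ≤ n j ∧ n j ≤ e j := by simp [hB]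
  set expo : (Fin 2 → ℤ) → (Fin 2 →₀ ℕ) :=
    fun n => Finsupp.equivFunOnFinite.symm fun j => (n j).toNat with hexpo
  have hfreq : ∀ n ∈ B, freq (expo n) = n := by
    intro n hn
    ext j
    simpa [freq, hexpo] using ((hmem n).1 hn j).1
  refine ⟨∑ n ∈ B, MvPolynomial.monomial (expo n) (UnitAddTorus.mFourierCoeff F n), ?_, ?_⟩
  · intro m hm j
    classical
    obtain ⟨n, hn, hmn⟩ := Finset.mem_biUnion.1 (MvPolynomial.support_sum hm)
    have : m = expo n := Finset.mem_singleton.1 (MvPolynomial.support_monomial_subset hmn)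
    subst this
    have h := congrFun (hfreq n hn) j
    rw [freq] at h
    rw [h]
    exact ((hmem n).1 hn j).2
  · have hzero : ∀ n ∉ B, UnitAddTorus.mFourierCoeff F n = 0 := by
      intro n hn
      rw [hmem, not_forall] at hn
      obtain ⟨j, hj⟩ := hn
      rcases lt_or_ge (n j) 0 with h | h
      · exact hpos n ⟨j, h⟩
      · exact hle n ⟨j, not_le.1 fun h' => hj ⟨h, h'⟩⟩
    filter_upwards [ae_eq_trigPoly hF hzero] with t ht
    rw [ht, map_sum]
    refine Finset.sum_congr rfl fun n hn => ?_
    have h : (fun j => (expo n j : ℤ)) = n := hfreq n hn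
    rw [MvPolynomial.eval_monomial, Finsupp.prod_fintype _ _ (by simp), prod_pt_pow, h]

/-- A quotient `q / p` in `L²` lies in `H²`. -/
theorem mem_H2_of_eq_div {N : ℕ} {p : MvPolynomial (Fin 2) ℂ}
    (hp : ∀ z ∈ bidisk, MvPolynomial.eval z p ≠ 0) {f : L2 N}
    {q : Fin N → MvPolynomial (Fin 2) ℂ}
    (hf : ∀ᵐ t ∂torusMeasure, ∀ i,
      f t i = MvPolynomial.eval (pt t) (q i) / MvPolynomial.eval (pt t) p) :
    f ∈ H2 N := by
  refine mem_fourierSupp_iff.2 fun i n hn => ?_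
  simp only [Set.mem_ofPred_eq, not_forall, not_le] at hn
  obtain ⟨j, hj⟩ := hn
  rw [mFourierCoeff_eq_mul]
  refine integral_trigPoly_div_eq_zero hp (q i).support (fun m => (q i).coeff m)
    (fun m => -n + freq m) (fun m _ => ⟨j, ?_⟩)
    (integrable_mFourier_mul (integrable_apply f i) _) ?_
  · simp only [Pi.add_apply, Pi.neg_apply, freq]
    omega
  · filter_upwards [hf] with t ht
    rw [ht i, mul_div_assoc', eval_pt, Finset.mul_sum]
    congr 1
    refine Finset.sum_congr rfl fun m _ => ?_
    rw [UnitAddTorus.mFourier_add]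
    ring

/-- If `g = ζ^a q / p̄` lies in `L²` and each exponent of `q` is less than `-a` in both
coordinates, then `g` lies in `L²₋₋`: the conjugates of the relevant Fourier coefficients are means
of quotients by `p`. -/
theorem mem_Lmm_of_eq_div_conj {N : ℕ} {p : MvPolynomial (Fin 2) ℂ}
    (hp : ∀ z ∈ bidisk, MvPolynomial.eval z p ≠ 0) {g : L2 N} (a : Fin 2 → ℤ)
    {q : Fin N → MvPolynomial (Fin 2) ℂ}
    (hq : ∀ i, ∀ m ∈ (q i).support, ∀ j, a j + m j < 0)
    (hg : ∀ᵐ t ∂torusMeasure, ∀ i, g t i = UnitAddTorus.mFourier a t *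
      (MvPolynomial.eval (pt t) (q i) / conj (MvPolynomial.eval (pt t) p))) :
    g ∈ Lmm N := by
  refine mem_fourierSupp_iff.2 fun i n hn => ?_
  simp only [Set.mem_ofPred_eq, not_forall, not_lt] at hn
  obtain ⟨j, hj⟩ := hn
  rw [mFourierCoeff_eq_mul, ← map_eq_zero (starRingEnd ℂ), ← integral_conj]
  refine integral_trigPoly_div_eq_zero hp (q i).support (fun m => conj ((q i).coeff m))
    (fun m => n - a - freq m) (fun m hm => ⟨j, ?_⟩)
    ((LinearIsometryEquiv.integrable_comp_iff Complex.conjLIE).2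
      (integrable_mFourier_mul (integrable_apply g i) _)) ?_
  · have := hq i m hm j
    simp only [Pi.sub_apply, freq]
    omega
  · filter_upwards [hg] with t ht
    rw [ht i, map_mul, map_mul, map_div₀, Complex.conj_conj, conj_eval_pt,
      ← UnitAddTorus.mFourier_neg, ← UnitAddTorus.mFourier_neg, neg_neg, ← mul_assoc,
      mul_div_assoc', Finset.mul_sum]
    congr 1
    refine Finset.sum_congr rfl fun m _ => ?_
    rw [sub_eq_add_neg, sub_eq_add_neg, UnitAddTorus.mFourier_add, UnitAddTorus.mFourier_add]
    ring

/-! ### Boundary values of rational inner functions -/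

theorem tendsto_ratFun {N : ℕ} (Q : MatPoly N) {p : MvPolynomial (Fin 2) ℂ} {t : Torus}
    (ht : MvPolynomial.eval (pt t) p ≠ 0) :
    Tendsto (fun r : ℝ => ratFun Q p ((r : ℂ) • pt t)) (𝓝[<] 1) (𝓝 (ratFun Q p (pt t))) := by
  have hr : Continuous fun r : ℝ => (r : ℂ) • pt t := by fun_prop
  have h1 : (((1 : ℝ) : ℂ)) • pt t = pt t := by rw [Complex.ofReal_one, one_smul]
  have hQ : Continuous fun r : ℝ => Q.map (MvPolynomial.eval ((r : ℂ) • pt t)) :=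
    continuous_matrix fun i k => (MvPolynomial.continuous_eval (Q i k)).comp hr
  have hcont : ContinuousAt (fun r : ℝ => ratFun Q p ((r : ℂ) • pt t)) 1 :=
    (((MvPolynomial.continuous_eval p).comp hr).continuousAt.inv₀
      (by simpa only [Function.comp_apply, h1] using ht)).smul hQ.continuousAt
  have h := hcont.tendsto
  rw [h1] at h
  exact h.mono_left nhdsWithin_le_nhds

theorem ratFun_reflectMat_pt {N : ℕ} (Q : MatPoly N) (p : MvPolynomial (Fin 2) ℂ) (t : Torus) :
    ratFun (reflectMat Q) p (pt t)
      = (UnitAddTorus.mFourier (fun j => (matDeg Q j : ℤ)) t * (MvPolynomial.eval (pt t) p)⁻¹) •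
        (Q.map (MvPolynomial.eval (pt t))).conjTranspose := by
  have hinv : (fun j => 1 / conj (pt t j)) = pt t := by
    ext j
    have h := Complex.mul_conj (pt t j)
    rw [Complex.normSq_eq_norm_sq, norm_pt, one_pow, Complex.ofReal_one] at h
    rw [div_eq_iff (by simpa using pt_ne_zero t j), h]
  rw [ratFun, eval_reflectMat _ _ (pt_ne_zero t), hinv, prod_pt_pow, smul_smul, mul_comm]

/-- The boundary values of `Q / p` and of `Q̃ / p`, and unitarity of the former. -/
theorem ae_bdry {N : ℕ} {Q : MatPoly N} {p : MvPolynomial (Fin 2) ℂ}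
    {φ : (Fin 2 → ℂ) → Matrix (Fin N) (Fin N) ℂ}
    (hp : ∀ z ∈ bidisk, MvPolynomial.eval z p ≠ 0)
    (hφ : ∀ z ∈ bidisk, φ z = ratFun Q p z) (hinner : IsInner φ) :
    ∀ᵐ t ∂torusMeasure, MvPolynomial.eval (pt t) p ≠ 0 ∧
      bdry φ t = ratFun Q p (pt t) ∧
      ratFun Q p (pt t) ∈ Matrix.unitaryGroup (Fin N) ℂ ∧
      bdry (ratFun (reflectMat Q) p) t = ratFun (reflectMat Q) p (pt t) := by
  filter_upwards [ae_eval_pt_ne_zero hp, hinner.unitary] with t ht hU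
  obtain ⟨U, hU, hlim⟩ := hU
  have hcongr : (fun r : ℝ => ratFun Q p ((r : ℂ) • pt t)) =ᶠ[𝓝[<] 1]
      fun r : ℝ => φ ((r : ℂ) • pt t) := by
    filter_upwards [Ioo_mem_nhdsLT (show (0 : ℝ) < 1 by norm_num)] with r hr
    refine (hφ _ (smul_pt_mem_bidisk ?_ t)).symm
    rw [Complex.norm_real, Real.norm_of_nonneg hr.1.le]
    exact hr.2
  have hφlim := (tendsto_ratFun Q ht).congr' hcongr
  refine ⟨ht, hφlim.limUnder_eq, ?_, (tendsto_ratFun _ ht).limUnder_eq⟩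
  rwa [tendsto_nhds_unique hφlim hlim]

theorem conjTranspose_mul_self_of_unitary {N : ℕ} {A : Matrix (Fin N) (Fin N) ℂ} {a : ℂ}
    (ha : a ≠ 0) (hU : a⁻¹ • A ∈ Matrix.unitaryGroup (Fin N) ℂ) :
    A.conjTranspose * A = (conj a * a) • (1 : Matrix (Fin N) (Fin N) ℂ) := by
  have h := Matrix.mem_unitaryGroup_iff'.1 hU
  have ha' : conj a ≠ 0 := by simpa using ha
  rw [Matrix.star_eq_conjTranspose, Matrix.conjTranspose_smul, Matrix.smul_mul, Matrix.mul_smul,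
    smul_smul, star_inv₀] at h
  rw [← h, smul_smul, RCLike.star_def]
  rw [show conj a * a * ((conj a)⁻¹ * a⁻¹) = 1 by field_simp, one_smul]

theorem mul_conjTranspose_self_of_unitary {N : ℕ} {A : Matrix (Fin N) (Fin N) ℂ} {a : ℂ}
    (ha : a ≠ 0) (hU : a⁻¹ • A ∈ Matrix.unitaryGroup (Fin N) ℂ) :
    A * A.conjTranspose = (conj a * a) • (1 : Matrix (Fin N) (Fin N) ℂ) := by
  have h := Matrix.mem_unitaryGroup_iff.1 hU
  have ha' : conj a ≠ 0 := by simpa using ha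
  rw [Matrix.star_eq_conjTranspose, Matrix.conjTranspose_smul, Matrix.smul_mul, Matrix.mul_smul,
    smul_smul, star_inv₀] at h
  rw [← h, smul_smul, RCLike.star_def]
  rw [show conj a * a * (a⁻¹ * (conj a)⁻¹) = 1 by field_simp, one_smul]

theorem norm_apply_le_of_unitary {N : ℕ} {A : Matrix (Fin N) (Fin N) ℂ} {a : ℂ}
    (hU : a⁻¹ • A ∈ Matrix.unitaryGroup (Fin N) ℂ) {c : ℂ} (hc : ‖c‖ = ‖a⁻¹‖) (i k : Fin N) :
    ‖(c • A.conjTranspose) i k‖ ≤ 1 := by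
  have h := entry_norm_bound_of_unitary hU k i
  rw [Matrix.smul_apply, smul_eq_mul, norm_mul] at h
  rwa [Matrix.smul_apply, smul_eq_mul, norm_mul, Matrix.conjTranspose_apply, norm_star, hc]

/-- Multiplication by a bounded measurable matrix function preserves `L²`. -/
theorem exists_mulVec {N : ℕ} {B : Torus → Matrix (Fin N) (Fin N) ℂ}
    (hmeas : ∀ i k, AEStronglyMeasurable (fun t => B t i k) torusMeasure)
    (hbdd : ∀ᵐ t ∂torusMeasure, ∀ i k, ‖B t i k‖ ≤ 1) (f : L2 N) :
    ∃ h : L2 N, ∀ᵐ t ∂torusMeasure, (h t).ofLp = (B t).mulVec (f t).ofLp := by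
  have hmem : MemLp (fun t => WithLp.toLp 2 ((B t).mulVec (f t).ofLp)) 2 torusMeasure := by
    refine MemLp.of_eval_piLp fun i => ?_
    have : MemLp (fun t => ∑ k, B t i k * f t k) 2 torusMeasure := by
      refine memLp_finsetSum _ fun k _ => ?_
      refine MemLp.of_le_mul (c := 1) (memLp_apply f k)
        ((hmeas i k).mul (memLp_apply f k).aestronglyMeasurable) ?_
      filter_upwards [hbdd] with t ht
      rw [norm_mul]
      exact mul_le_mul_of_nonneg_right (ht i k) (norm_nonneg _)
    exact this
  refine ⟨hmem.toLp _, ?_⟩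
  filter_upwards [hmem.coeFn_toLp] with t ht
  rw [ht]

theorem aestronglyMeasurable_conjTranspose {N : ℕ} (Q : MatPoly N) {c : Torus → ℂ}
    (hc : Measurable c) (i k : Fin N) :
    AEStronglyMeasurable
      (fun t => (c t • (Q.map (MvPolynomial.eval (pt t))).conjTranspose) i k) torusMeasure := by
  have h : Measurable fun t => MvPolynomial.eval (pt t) (Q k i) :=
    ((MvPolynomial.continuous_eval (Q k i)).comp continuous_pt).measurable
  exact (hc.mul (Complex.continuous_conj.measurable.comp h)).aestronglyMeasurable

/-! ### The canonical subspaces -/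

theorem degreeOf_le_matDeg {N : ℕ} (Q : MatPoly N) (i k : Fin N) (j : Fin 2) :
    (Q i k).degreeOf j ≤ matDeg Q j :=
  (Finset.le_sup (f := fun k' => (Q i k').degreeOf j) (Finset.mem_univ k)).trans
    (Finset.le_sup (f := fun i' => Finset.univ.sup fun k' => (Q i' k').degreeOf j)
      (Finset.mem_univ i))

theorem memLp_eval_mul (q : MvPolynomial (Fin 2) ℂ) {F : Torus → ℂ}
    (hF : MemLp F 2 torusMeasure) :
    MemLp (fun t => MvPolynomial.eval (pt t) q * F t) 2 torusMeasure := by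
  have hc : Continuous fun t => MvPolynomial.eval (pt t) q :=
    (MvPolynomial.continuous_eval q).comp continuous_pt
  obtain ⟨C, hC⟩ := isCompact_univ.exists_bound_of_continuousOn hc.continuousOn
  refine MemLp.of_le_mul (c := C) hF (hc.aestronglyMeasurable.mul hF.aestronglyMeasurable) ?_
  filter_upwards with t
  rw [norm_mul]
  exact mul_le_mul_of_nonneg_right (hC t (Set.mem_univ t)) (norm_nonneg _)

/-- Multiplication by a polynomial preserves the absence of negative frequencies. -/
theorem mFourierCoeff_eval_mul_of_mem_H2 {N : ℕ} (q : MvPolynomial (Fin 2) ℂ) {f : L2 N}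
    (hf : f ∈ H2 N) (k : Fin N) {n : Fin 2 → ℤ} (hn : ∃ j, n j < 0) :
    UnitAddTorus.mFourierCoeff (fun t => MvPolynomial.eval (pt t) q * f t k) n = 0 := by
  rw [mFourierCoeff_eval_mul q (integrable_apply f k)]
  refine Finset.sum_eq_zero fun m _ => ?_
  rw [mem_fourierSupp_iff.1 hf k, mul_zero]
  obtain ⟨j, hj⟩ := hn
  simp only [Set.mem_ofPred_eq, not_forall, not_le]
  refine ⟨j, ?_⟩
  simp only [Pi.sub_apply, freq]
  omega

/-- A function in `L²₋₋` times a trigonometric polynomial with frequencies at most `b` has no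
frequencies beyond `b - 1`. -/
theorem mFourierCoeff_trigPoly_mul_of_mem_Lmm {N : ℕ} {ι : Type*} (S : Finset ι) (c : ι → ℂ)
    (κ : ι → Fin 2 → ℤ) {b : Fin 2 → ℤ} (hκ : ∀ i ∈ S, ∀ j, κ i j ≤ b j) {g : L2 N}
    (hg : g ∈ Lmm N) (k : Fin N) {n : Fin 2 → ℤ} (hn : ∃ j, b j - 1 < n j) :
    UnitAddTorus.mFourierCoeff
      (fun t => (∑ i ∈ S, c i * UnitAddTorus.mFourier (κ i) t) * g t k) n = 0 := by
  rw [mFourierCoeff_trigPoly_mul S c κ (integrable_apply g k)]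
  refine Finset.sum_eq_zero fun i hi => ?_
  rw [mem_fourierSupp_iff.1 hg k, mul_zero]
  obtain ⟨j, hj⟩ := hn
  simp only [Set.mem_ofPred_eq, not_forall, not_lt]
  refine ⟨j, ?_⟩
  have := hκ i hi j
  simp only [Pi.sub_apply]
  omega

/-- If `p f` has Fourier support in the box `0 ≤ n ≤ e`, then `f` is a quotient `q / p` with `q` of
degree at most `e`. -/
theorem mem_P_of_fourierSupp {N : ℕ} {p : MvPolynomial (Fin 2) ℂ}
    (hp : ∀ z ∈ bidisk, MvPolynomial.eval z p ≠ 0) {f : L2 N} (e : Fin 2 → ℤ)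
    (hpos : ∀ i n, (∃ j, n j < 0) →
      UnitAddTorus.mFourierCoeff (fun t => MvPolynomial.eval (pt t) p * f t i) n = 0)
    (hle : ∀ i n, (∃ j, e j < n j) →
      UnitAddTorus.mFourierCoeff (fun t => MvPolynomial.eval (pt t) p * f t i) n = 0) :
    f ∈ P N e p := by
  choose q hq hqf using fun i =>
    exists_poly_of_fourierSupp (memLp_eval_mul p (memLp_apply f i)) e (hpos i) (hle i)
  have hf : ∀ᵐ t ∂torusMeasure, ∀ i,
      f t i = MvPolynomial.eval (pt t) (q i) / MvPolynomial.eval (pt t) p := by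
    filter_upwards [ae_all_iff.2 hqf, ae_eval_pt_ne_zero hp] with t ht hne i
    rw [eq_div_iff hne, ← ht i, mul_comm]
  exact ⟨mem_H2_of_eq_div hp hf, q, hq, hf⟩

theorem integrable_trigPoly_mul {ι : Type*} (S : Finset ι) (c : ι → ℂ) (κ : ι → Fin 2 → ℤ)
    {F : Torus → ℂ} (hF : Integrable F torusMeasure) :
    Integrable (fun t => (∑ i ∈ S, c i * UnitAddTorus.mFourier (κ i) t) * F t) torusMeasure := by
  simp_rw [Finset.sum_mul, mul_assoc]
  exact integrable_finsetSum _ fun i _ => (integrable_mFourier_mul hF _).const_mul _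

theorem mFourier_mul_neg (s : Fin 2 → ℤ) (t : Torus) :
    UnitAddTorus.mFourier s t * UnitAddTorus.mFourier (-s) t = 1 := by
  rw [← UnitAddTorus.mFourier_add, add_neg_cancel, UnitAddTorus.mFourier_zero]
  rfl

/-- If `f = ζ^s φ g` with `f ∈ H²` and `g ∈ L²₋₋`, then `p f = ζ^s Q g` has Fourier support in a
bounded box, so `f` is a quotient `q / p`. The same applies to `φ̃ f`, because
`p φ̃ f = Q̃ f = ζ^(d + s) p̄ g`. -/
theorem mem_P_of_mem_mulImage {N : ℕ} {Q : MatPoly N} {p : MvPolynomial (Fin 2) ℂ}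
    {φ : (Fin 2 → ℂ) → Matrix (Fin N) (Fin N) ℂ}
    (hp : ∀ z ∈ bidisk, MvPolynomial.eval z p ≠ 0)
    (hφ : ∀ z ∈ bidisk, φ z = ratFun Q p z) (hinner : IsInner φ) (s : Fin 2 → ℤ) {f : L2 N}
    (hf : f ∈ H2 N)
    (hfg : f ∈ mulImage (fun t => UnitAddTorus.mFourier s t • bdry φ t) (Lmm N)) :
    f ∈ P N (fun j => matDeg Q j - 1 + s j) p ∧
      f ∈ mulPreimage (bdry (ratFun (reflectMat Q) p))
        (P N (fun j => matDeg Q j - 1 + s j) p) := by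
  obtain ⟨g, hg, hfg⟩ := hfg
  have hae := ae_bdry hp hφ hinner
  set d : Fin 2 → ℤ := fun j => (matDeg Q j : ℤ) with hd
  have hpmeas : Measurable fun t => MvPolynomial.eval (pt t) p :=
    ((MvPolynomial.continuous_eval p).comp continuous_pt).measurable
  obtain ⟨h, hh⟩ := exists_mulVec
    (B := fun t => (UnitAddTorus.mFourier d t * (MvPolynomial.eval (pt t) p)⁻¹) •
      (Q.map (MvPolynomial.eval (pt t))).conjTranspose)
    (aestronglyMeasurable_conjTranspose Q
      ((UnitAddTorus.mFourier d).continuous.measurable.mul hpmeas.inv))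
    (by
      filter_upwards [hae] with t ht i k
      refine norm_apply_le_of_unitary ht.2.2.1 ?_ i k
      rw [norm_mul, norm_mFourier_apply, one_mul]) f
  refine ⟨mem_P_of_fourierSupp hp _ (fun i n hn => mFourierCoeff_eval_mul_of_mem_H2 p hf i hn)
    fun i n hn => ?_, h, mem_P_of_fourierSupp hp _ (fun i n hn => ?_) (fun i n hn => ?_), ?_⟩
  -- `p f = ζ^s Q g` has no frequencies beyond `d + s - 1`
  · have heq : (fun t => MvPolynomial.eval (pt t) p * f t i) =ᵐ[torusMeasure] fun t =>
        ∑ k, (∑ m ∈ (Q i k).support,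
          (Q i k).coeff m * UnitAddTorus.mFourier (s + freq m) t) * g t k := by
      filter_upwards [hae, hfg] with t ht hft
      have hk : ∀ k, (∑ m ∈ (Q i k).support,
          (Q i k).coeff m * UnitAddTorus.mFourier (s + freq m) t)
          = UnitAddTorus.mFourier s t * MvPolynomial.eval (pt t) (Q i k) := by
        intro k
        rw [eval_pt, Finset.mul_sum]
        refine Finset.sum_congr rfl fun m _ => ?_
        rw [UnitAddTorus.mFourier_add]
        ring
      simp_rw [hk]
      rw [hft, ht.2.1, ratFun, Matrix.smul_mulVec, Matrix.smul_mulVec, Pi.smul_apply,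
        Pi.smul_apply, Matrix.mulVec, dotProduct, smul_eq_mul, smul_eq_mul, mul_left_comm,
        mul_inv_cancel_left₀ ht.1, Finset.mul_sum]
      exact Finset.sum_congr rfl fun k _ => by rw [Matrix.map_apply, mul_assoc]
    rw [mFourierCoeff_congr heq, mFourierCoeff_finsetSum _ fun k _ =>
      integrable_trigPoly_mul _ _ _ (integrable_apply g k)]
    refine Finset.sum_eq_zero fun k _ =>
      mFourierCoeff_trigPoly_mul_of_mem_Lmm _ _ _ (b := s + d) ?_ hg k ?_
    · intro m hm j
      have := (MvPolynomial.monomial_le_degreeOf j hm).trans (degreeOf_le_matDeg Q i k j)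
      simp only [Pi.add_apply, freq, hd]
      omega
    · obtain ⟨j, hj⟩ := hn
      refine ⟨j, ?_⟩
      simp only [Pi.add_apply, hd]
      omega
  -- `p φ̃ f = Q̃ f` has no negative frequencies
  · have heq : (fun t => MvPolynomial.eval (pt t) p * h t i) =ᵐ[torusMeasure] fun t =>
        ∑ k, MvPolynomial.eval (pt t) (reflectMat Q i k) * f t k := by
      filter_upwards [hae, hh] with t ht hht
      rw [hht, ← ratFun_reflectMat_pt, ratFun, Matrix.smul_mulVec, Pi.smul_apply, smul_eq_mul,
        mul_inv_cancel_left₀ ht.1]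
      rfl
    rw [mFourierCoeff_congr heq, mFourierCoeff_finsetSum _ fun k _ =>
      (memLp_eval_mul _ (memLp_apply f k)).integrable (by norm_num)]
    exact Finset.sum_eq_zero fun k _ => mFourierCoeff_eval_mul_of_mem_H2 _ hf k hn
  -- `p φ̃ f = ζ^(d + s) p̄ g`, from `Q^* Q = |p|²`, has no frequencies beyond `d + s - 1`
  · have heq : (fun t => MvPolynomial.eval (pt t) p * h t i) =ᵐ[torusMeasure] fun t =>
        (∑ m ∈ p.support, conj (p.coeff m) * UnitAddTorus.mFourier (d + s + -freq m) t) *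
          g t i := by
      filter_upwards [hae, hh, hfg] with t ht hht hft
      have hsum : (∑ m ∈ p.support, conj (p.coeff m) * UnitAddTorus.mFourier (d + s + -freq m) t)
          = UnitAddTorus.mFourier d t * UnitAddTorus.mFourier s t *
            conj (MvPolynomial.eval (pt t) p) := by
        rw [conj_eval_pt, Finset.mul_sum]
        refine Finset.sum_congr rfl fun m _ => ?_
        rw [UnitAddTorus.mFourier_add, UnitAddTorus.mFourier_add]
        ring
      rw [hsum, hht, hft, ht.2.1, ratFun, Matrix.mulVec_mulVec, Matrix.smul_mul, Matrix.mul_smul,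
        Matrix.mul_smul, conjTranspose_mul_self_of_unitary ht.1 ht.2.2.1]
      simp only [Matrix.smul_mulVec, Matrix.one_mulVec, Pi.smul_apply, smul_eq_mul]
      have := ht.1
      field_simp
    rw [mFourierCoeff_congr heq]
    refine mFourierCoeff_trigPoly_mul_of_mem_Lmm _ _ _ (b := d + s) ?_ hg i ?_
    · intro m _ j
      simp only [Pi.add_apply, Pi.neg_apply, freq]
      omega
    · obtain ⟨j, hj⟩ := hn
      refine ⟨j, ?_⟩
      simp only [Pi.add_apply, hd]
      omega
  · filter_upwards [hae, hh] with t ht hht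
    rw [hht, ht.2.2.2, ratFun_reflectMat_pt]

/-- If `φ̃ f = q / p` with `q` of degree at most `d - 1 + s`, then `g = ζ^(-s) φ^* f` equals
`ζ^(-s - d) q / p̄`, which lies in `L²₋₋`, and `f = ζ^s φ g`. -/
theorem mem_mulImage_of_mem_mulPreimage {N : ℕ} {Q : MatPoly N} {p : MvPolynomial (Fin 2) ℂ}
    {φ : (Fin 2 → ℂ) → Matrix (Fin N) (Fin N) ℂ}
    (hp : ∀ z ∈ bidisk, MvPolynomial.eval z p ≠ 0)
    (hφ : ∀ z ∈ bidisk, φ z = ratFun Q p z) (hinner : IsInner φ) (s : Fin 2 → ℤ) {f : L2 N}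
    (hf : f ∈ mulPreimage (bdry (ratFun (reflectMat Q) p))
        (P N (fun j => matDeg Q j - 1 + s j) p)) :
    f ∈ mulImage (fun t => UnitAddTorus.mFourier s t • bdry φ t) (Lmm N) := by
  obtain ⟨h, ⟨-, q, hq, hhq⟩, hhf⟩ := hf
  have hae := ae_bdry hp hφ hinner
  set d : Fin 2 → ℤ := fun j => (matDeg Q j : ℤ) with hd
  have hpmeas : Measurable fun t => MvPolynomial.eval (pt t) p :=
    ((MvPolynomial.continuous_eval p).comp continuous_pt).measurable
  obtain ⟨g, hg⟩ := exists_mulVec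
    (B := fun t => (UnitAddTorus.mFourier (-s) t * (conj (MvPolynomial.eval (pt t) p))⁻¹) •
      (Q.map (MvPolynomial.eval (pt t))).conjTranspose)
    (aestronglyMeasurable_conjTranspose Q
      ((UnitAddTorus.mFourier (-s)).continuous.measurable.mul
        (Complex.continuous_conj.measurable.comp hpmeas).inv))
    (by
      filter_upwards [hae] with t ht i k
      refine norm_apply_le_of_unitary ht.2.2.1 ?_ i k
      rw [norm_mul, norm_mFourier_apply, one_mul, norm_inv, norm_inv, RCLike.norm_conj]) f
  refine ⟨g, mem_Lmm_of_eq_div_conj hp (-(s + d)) (q := q) (fun i m hm j => ?_) ?_, ?_⟩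
  · have : (m j : ℤ) ≤ matDeg Q j - 1 + s j := hq i m hm j
    simp only [Pi.neg_apply, Pi.add_apply, hd]
    omega
  · filter_upwards [hae, hg, hhf, hhq] with t ht hgt hht hqt i
    have h1 := congrFun hht i
    rw [ht.2.2.2, ratFun_reflectMat_pt, Matrix.smul_mulVec, Pi.smul_apply, smul_eq_mul,
      show (h t).ofLp i = h t i from rfl, hqt i] at h1
    -- the equation `φ̃ f = q / p`, solved for `Q^* f`
    have hA : ((Q.map (MvPolynomial.eval (pt t))).conjTranspose.mulVec (f t).ofLp) i
        = UnitAddTorus.mFourier (-d) t * MvPolynomial.eval (pt t) (q i) := by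
      have hne := ht.1
      have hw := mFourier_mul_neg d t
      rw [div_eq_iff hne] at h1
      rw [h1]
      field_simp
      linear_combination (-(Q.map (MvPolynomial.eval (pt t))).conjTranspose.mulVec (f t).ofLp i)
        * hw
    have h2 := congrFun hgt i
    rw [Matrix.smul_mulVec, Pi.smul_apply, smul_eq_mul, hA] at h2
    rw [show g t i = (g t).ofLp i from rfl, h2, neg_add, UnitAddTorus.mFourier_add]
    ring
  · filter_upwards [hae, hg] with t ht hgt
    have hne := ht.1
    have hne' : conj (MvPolynomial.eval (pt t) p) ≠ 0 := by simpa using hne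
    rw [hgt, ht.2.1, ratFun, Matrix.mulVec_mulVec, Matrix.smul_mul, Matrix.smul_mul,
      Matrix.mul_smul, mul_conjTranspose_self_of_unitary ht.1 ht.2.2.1, smul_smul, smul_smul,
      smul_smul, Matrix.smul_mulVec, Matrix.one_mulVec]
    have hc : UnitAddTorus.mFourier s t * (MvPolynomial.eval (pt t) p)⁻¹ *
        (UnitAddTorus.mFourier (-s) t * (conj (MvPolynomial.eval (pt t) p))⁻¹) *
        (conj (MvPolynomial.eval (pt t) p) * MvPolynomial.eval (pt t) p) = 1 := by
      field_simp
      exact mFourier_mul_neg s t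
    simp only [hc, one_smul]

/-- The common form of the three descriptions, for `H² ∩ ζ^s φ L²₋₋` with any shift `s`. -/
theorem coe_H2_inf_mulImage {N : ℕ} {Q : MatPoly N} {p : MvPolynomial (Fin 2) ℂ}
    {φ : (Fin 2 → ℂ) → Matrix (Fin N) (Fin N) ℂ}
    (hp : ∀ z ∈ bidisk, MvPolynomial.eval z p ≠ 0)
    (hφ : ∀ z ∈ bidisk, φ z = ratFun Q p z) (hinner : IsInner φ) {s e : Fin 2 → ℤ}
    {Φ : Torus → Matrix (Fin N) (Fin N) ℂ}
    (hΦ : ∀ t, Φ t = UnitAddTorus.mFourier s t • bdry φ t)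
    (he : ∀ j, e j = matDeg Q j - 1 + s j) :
    ((H2 N ⊓ mulImage Φ (Lmm N) : Submodule ℂ (L2 N)) : Set (L2 N))
      = {f | f ∈ P N e p ∧ f ∈ mulPreimage (bdry (ratFun (reflectMat Q) p)) (P N e p)} := by
  obtain rfl : e = fun j => matDeg Q j - 1 + s j := funext he
  obtain rfl : Φ = fun t => UnitAddTorus.mFourier s t • bdry φ t := funext hΦ
  ext f
  exact ⟨fun h => mem_P_of_mem_mulImage hp hφ hinner s h.1 h.2,
    fun h => ⟨h.1.1, mem_mulImage_of_mem_mulPreimage hp hφ hinner s h.2⟩⟩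

/-! ### Finite dimensionality -/

/-- The boundary function `q / p`, where the components of `q` have exponents in a finite set `B`:
`q i = ∑ m ∈ B, c i m z^m`. -/
noncomputable def quotFun {N : ℕ} (p : MvPolynomial (Fin 2) ℂ) {B : Finset (Fin 2 →₀ ℕ)}
    (c : Fin N → B → ℂ) (t : Torus) : EuclideanSpace ℂ (Fin N) :=
  (MvPolynomial.eval (pt t) p)⁻¹ •
    WithLp.toLp 2 fun i => ∑ m : B, c i m * UnitAddTorus.mFourier (freq m) t

theorem aestronglyMeasurable_quotFun {N : ℕ} (p : MvPolynomial (Fin 2) ℂ)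
    {B : Finset (Fin 2 →₀ ℕ)} (c : Fin N → B → ℂ) :
    AEStronglyMeasurable (quotFun p c) torusMeasure := by
  have h1 : Measurable fun t => (MvPolynomial.eval (pt t) p)⁻¹ :=
    ((MvPolynomial.continuous_eval p).comp continuous_pt).measurable.inv
  have h2 : Continuous fun t => (WithLp.toLp 2 fun i =>
      ∑ m : B, c i m * UnitAddTorus.mFourier (freq m) t : EuclideanSpace ℂ (Fin N)) :=
    (PiLp.continuous_toLp 2 _).comp <| continuous_pi fun i => continuous_finsetSum _ fun m _ =>
      continuous_const.mul (UnitAddTorus.mFourier (freq m)).continuous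
  exact h1.aestronglyMeasurable.smul h2.aestronglyMeasurable

/-- The linear map sending coefficients `c` to the class of `q / p` modulo null sets. It takes
values in all measurable functions, since `q / p` need not be square integrable. -/
noncomputable def quotMap (N : ℕ) (p : MvPolynomial (Fin 2) ℂ) (B : Finset (Fin 2 →₀ ℕ)) :
    (Fin N → B → ℂ) →ₗ[ℂ] (Torus →ₘ[torusMeasure] EuclideanSpace ℂ (Fin N)) where
  toFun c := AEEqFun.mk (quotFun p c) (aestronglyMeasurable_quotFun p c)
  map_add' c c' := by
    rw [AEEqFun.mk_add_mk]
    congr 1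
    ext t i
    simp [quotFun, add_mul, Finset.sum_add_distrib, mul_add]
  map_smul' a c := by
    refine Eq.trans ?_ (AEEqFun.smul_mk a _ (aestronglyMeasurable_quotFun p c))
    congr 1
    ext t i
    simp [quotFun, Finset.mul_sum, mul_assoc, mul_left_comm]

/-- A member of `P` is determined modulo null sets by the finitely many coefficients of its
numerator. -/
theorem finiteDimensional_P (N : ℕ) (e : Fin 2 → ℤ) (p : MvPolynomial (Fin 2) ℂ) :
    FiniteDimensional ℂ (P N e p) := by
  set B : Finset (Fin 2 →₀ ℕ) :=
    Finset.Iic (Finsupp.equivFunOnFinite.symm fun j => (e j).toNat) with hB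
  let incl : L2 N →ₗ[ℂ] (Torus →ₘ[torusMeasure] EuclideanSpace ℂ (Fin N)) :=
    { toFun := fun f => f, map_add' := fun _ _ => rfl, map_smul' := fun _ _ => rfl }
  have hrange : ∀ f : P N e p, (incl.comp (P N e p).subtype) f ∈ (quotMap N p B).range := by
    rintro ⟨f, -, q, hq, hf⟩
    refine ⟨fun i m => (q i).coeff m, ?_⟩
    refine AEEqFun.ext ((AEEqFun.coeFn_mk _ _).trans ?_)
    filter_upwards [hf] with t ht
    ext i
    change (MvPolynomial.eval (pt t) p)⁻¹ *
      (∑ m : B, (q i).coeff m * UnitAddTorus.mFourier (freq m) t) = f t i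
    have hsub : (q i).support ⊆ B := by
      intro m hm
      rw [hB, Finset.mem_Iic]
      intro j
      have := hq i m hm j
      simp only [Finsupp.equivFunOnFinite_symm_apply_apply]
      omega
    rw [ht i, eval_pt (q i), Finset.sum_subset hsub fun m _ hm => by
      rw [MvPolynomial.notMem_support_iff.1 hm, zero_mul], div_eq_inv_mul,
      ← Finset.sum_coe_sort B]
  exact Module.Finite.of_injective ((incl.comp (P N e p).subtype).codRestrict _ hrange)
    fun f g h => by
      have h' := Subtype.ext_iff.1 h
      exact Subtype.ext (Subtype.ext h')

theorem finiteDimensional_of_coe_eq {N : ℕ} {e : Fin 2 → ℤ} {p : MvPolynomial (Fin 2) ℂ}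
    {W : Submodule ℂ (L2 N)} {X : Set (L2 N)}
    (h : (W : Set (L2 N)) = {f | f ∈ P N e p ∧ f ∈ X}) : FiniteDimensional ℂ W := by
  have := finiteDimensional_P N e p
  refine Submodule.finiteDimensional_of_le (S₂ := P N e p) fun f hf => ?_
  have hf' : f ∈ (W : Set (L2 N)) := hf
  rw [h] at hf'
  exact hf'.1

theorem mFourier_single_eq_pt (j : Fin 2) (t : Torus) :
    UnitAddTorus.mFourier (Pi.single j 1) t = pt t j := by
  rw [UnitAddTorus.mFourier_single, fourier_one, pt]

end Bidisk

theorem mainTheorem2 (N : ℕ) (Q : Bidisk.MatPoly N) (p : MvPolynomial (Fin 2) ℂ)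
    (φ : (Fin 2 → ℂ) → Matrix (Fin N) (Fin N) ℂ)
    (hp : ∀ z ∈ Bidisk.bidisk, MvPolynomial.eval z p ≠ 0)
    (hφ : ∀ z ∈ Bidisk.bidisk, φ z = Bidisk.ratFun Q p z)
    (hinner : Bidisk.IsInner φ)
    (d₁ d₂ : ℕ) (hd₁ : d₁ = Bidisk.matDeg Q 0) (hd₂ : d₂ = Bidisk.matDeg Q 1)
    (φt : (Fin 2 → ℂ) → Matrix (Fin N) (Fin N) ℂ)
    (hφt : φt = Bidisk.ratFun (Bidisk.reflectMat Q) p)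
    (P₀ P₁ P₂ : Submodule ℂ (Bidisk.L2 N))
    (hP₀ : P₀ = Bidisk.P N ![(d₁ : ℤ) - 1, (d₂ : ℤ) - 1] p)
    (hP₁ : P₁ = Bidisk.P N ![(d₁ : ℤ), (d₂ : ℤ) - 1] p)
    (hP₂ : P₂ = Bidisk.P N ![(d₁ : ℤ) - 1, (d₂ : ℤ)] p) :
    ((Bidisk.K φ : Set (Bidisk.L2 N))
        = {f | f ∈ P₀ ∧ f ∈ Bidisk.mulPreimage (Bidisk.bdry φt) P₀}) ∧
    ((Bidisk.Kj 0 φ : Set (Bidisk.L2 N))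
        = {f | f ∈ P₁ ∧ f ∈ Bidisk.mulPreimage (Bidisk.bdry φt) P₁}) ∧
    ((Bidisk.Kj 1 φ : Set (Bidisk.L2 N))
        = {f | f ∈ P₂ ∧ f ∈ Bidisk.mulPreimage (Bidisk.bdry φt) P₂}) ∧
    FiniteDimensional ℂ (Bidisk.K φ) ∧
    FiniteDimensional ℂ (Bidisk.Kj 0 φ) ∧
    FiniteDimensional ℂ (Bidisk.Kj 1 φ) := by
  subst hd₁ hd₂ hφt hP₀ hP₁ hP₂
  have h₀ : (Bidisk.K φ : Set (Bidisk.L2 N)) =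
      {f | f ∈ Bidisk.P N ![(Bidisk.matDeg Q 0 : ℤ) - 1, (Bidisk.matDeg Q 1 : ℤ) - 1] p ∧ _} :=
    Bidisk.coe_H2_inf_mulImage hp hφ hinner (s := 0)
      (fun t => by rw [UnitAddTorus.mFourier_zero, ContinuousMap.one_apply, one_smul])
      (fun j => by fin_cases j <;> simp)
  have h₁ : (Bidisk.Kj 0 φ : Set (Bidisk.L2 N)) =
      {f | f ∈ Bidisk.P N ![(Bidisk.matDeg Q 0 : ℤ), (Bidisk.matDeg Q 1 : ℤ) - 1] p ∧ _} :=
    Bidisk.coe_H2_inf_mulImage hp hφ hinner (s := Pi.single 0 1)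
      (fun t => by rw [Bidisk.mFourier_single_eq_pt])
      (fun j => by fin_cases j <;> simp)
  have h₂ : (Bidisk.Kj 1 φ : Set (Bidisk.L2 N)) =
      {f | f ∈ Bidisk.P N ![(Bidisk.matDeg Q 0 : ℤ) - 1, (Bidisk.matDeg Q 1 : ℤ)] p ∧ _} :=
    Bidisk.coe_H2_inf_mulImage hp hφ hinner (s := Pi.single 1 1)
      (fun t => by rw [Bidisk.mFourier_single_eq_pt])
      (fun j => by fin_cases j <;> simp)
  exact ⟨h₀, h₁, h₂, Bidisk.finiteDimensional_of_coe_eq h₀,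
    Bidisk.finiteDimensional_of_coe_eq h₁, Bidisk.finiteDimensional_of_coe_eq h₂⟩
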